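/- Let $b\ge 2$ be an even integer. Consider the two-player impartial game whose positions are the integers $n\ge 1$, in which a player at a position $n\ge 2$ moves either to $n-1$ or to $\lceil n/b\rceil$, and in which $1$ is the final position (no move is possible from it). Let $SG_{1,b}(n)$ be the Sprague–Grundy value of the position $n$, so that $SG_{1,b}(1)=0$ and, for $n\ge 2$, $$SG_{1,b}(n)=\operatorname{mex}\{SG_{1,b}(n-1),\,SG_{1,b}(\lceil n/b\rceil)\},$$ where $\operatorname{mex} A$ is the smallest non-negative integer that is not in $A$. Then the sequence $\{SG_{1,b}(n)\}_{n\ge 1}$ is $b$-automatic; that is, there is a deterministic finite automaton with output which, for every $n\ge 1$, outputs $SG_{1,b}(n)$ whenever it reads a word of base-$b$ digits representing $n$ (most significant digit first, leading zeros allowed). -/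

import Mathlib

/-- The moves `n → m` of the subtraction–division game `G_{1,b}`, in which the total is reduced
by subtracting `1` or by dividing by `b` and rounding up. The positions are the totals `n ≥ 1`;
a move must strictly reduce the total, so the total `1` is the final position. -/
def IsMove (b n m : ℕ) : Prop :=
  1 ≤ m ∧ m < n ∧ (m = n - 1 ∨ m = n ⌈/⌉ b)

/-- The minimum excluded value: the least natural number that is not in `A`. -/
noncomputable def mex (A : Set ℕ) : ℕ := sInf Aᶜ

/-- The Sprague–Grundy value `SG_{1,b}(n)`: the mex of the values of the positions that can be
reached from `n` in one move (so it is `0` at the final position `1`). -/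
noncomputable def SG (b n : ℕ) : ℕ :=
  mex {v | ∃ m, ∃ _h : IsMove b n m, v = SG b m}
termination_by n
decreasing_by exact _h.2.1

/-- A deterministic automaton with output: input alphabet `α`, states `σ`, output alphabet `Δ`. -/
structure DFAO (α σ Δ : Type*) where
  /-- The transition function. -/
  step : σ → α → σ
  /-- The initial state. -/
  start : σ
  /-- The output function. -/
  out : σ → Δ

/-- The output of the automaton after reading the word `w` from left to right. -/
def DFAO.eval {α σ Δ : Type*} (M : DFAO α σ Δ) (w : List α) : Δ :=
  M.out (w.foldl M.step M.start)

/-- The number that is written by the word `w` of base-`k` digits, most significant digit first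
(leading zeros are allowed). -/
def wordValue {k : ℕ} (w : List (Fin k)) : ℕ :=
  w.foldl (fun x d => k * x + (d : ℕ)) 0

/-- The sequence `a 1, a 2, a 3, …` is `k`-automatic: some automaton with finitely many states
and with output returns `a n` whenever it reads base-`k` digits of `n`. -/
def IsAutomatic {Δ : Type*} (k : ℕ) (a : ℕ → Δ) : Prop :=
  ∃ (σ : Type) (_ : Finite σ) (M : DFAO (Fin k) σ Δ),
    ∀ n : ℕ, 1 ≤ n → ∀ w : List (Fin k), wordValue w = n → M.eval w = a n

/-! All positions `b * n + d` with `1 ≤ d ≤ b` have the same quotient `n + 1`, so along such a block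
the values arise by iterating `mexPair c` with `c = SG b (n + 1)`. For even `b`, a full block sends
a nonzero entry value to itself if `c = 0`, and to `3 - c` otherwise. As adjacent values differ, two
zeros are never adjacent, so the value at a multiple of `b` depends on at most two neighbouring
values one level down (`SG_mul_eq`). Hence the finite state `SGState` at `n` and a digit `d`
determine the state at `b * n + d`. -/

/-- The minimum excluded value of the pair `{c, x}`. -/
def mexPair (c x : ℕ) : ℕ :=
  if c ≠ 0 ∧ x ≠ 0 then 0 else if c ≠ 1 ∧ x ≠ 1 then 1 else 2

theorem mexPair_le_two (c x : ℕ) : mexPair c x ≤ 2 := by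
  unfold mexPair; split_ifs <;> omega

theorem mexPair_ne_right (c x : ℕ) : mexPair c x ≠ x := by
  unfold mexPair; split_ifs <;> omega

theorem mex_pair (x c : ℕ) : mex {x, c} = mexPair c x := by
  refine IsLeast.csInf_eq ⟨?_, ?_⟩
  · simp only [Set.mem_compl_iff, Set.mem_insert_iff, Set.mem_singleton_iff]
    unfold mexPair; split_ifs <;> omega
  · intro y hy
    simp only [Set.mem_compl_iff, Set.mem_insert_iff, Set.mem_singleton_iff] at hy
    unfold mexPair; split_ifs <;> omega

theorem mex_empty : mex ∅ = 0 := by simp [mex]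

theorem SG_of_le_one (b : ℕ) {n : ℕ} (hn : n ≤ 1) : SG b n = 0 := by
  rw [SG, ← mex_empty]
  congr 1
  ext v
  simp only [Set.mem_ofPred_eq, Set.mem_empty_iff_false, iff_false]
  rintro ⟨m, ⟨h1, h2, -⟩, -⟩
  omega

theorem ceilDiv_mul_add {b n d : ℕ} (hd : 1 ≤ d) (hdb : d ≤ b) :
    (b * n + d) ⌈/⌉ b = n + 1 := by
  rw [Nat.ceilDiv_eq_add_pred_div]
  have : b * n + d + b - 1 = (d - 1) + b * (n + 1) := by
    rw [mul_add]; omega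
  rw [this, Nat.add_mul_div_left _ _ (by omega), Nat.div_eq_of_lt (by omega)]
  omega

/-- The value of `SG` at a position is obtained from the value at its predecessor and the value
that is shared by the quotients of its block. -/
theorem SG_mul_add_succ {b n d : ℕ} (hb : 2 ≤ b) (hd : d < b) (h : 1 ≤ b * n + d) :
    SG b (b * n + d + 1) = mexPair (SG b (n + 1)) (SG b (b * n + d)) := by
  have hc : (b * n + d + 1) ⌈/⌉ b = n + 1 := ceilDiv_mul_add (d := d + 1) (by omega) hd
  have hlt : n + 1 < b * n + d + 1 := by
    rcases Nat.eq_zero_or_pos n with rfl | hn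
    · omega
    · nlinarith
  rw [SG, ← mex_pair]
  congr 1
  ext v
  simp only [IsMove, hc, Set.mem_ofPred_eq, Set.mem_insert_iff, Set.mem_singleton_iff]
  constructor
  · rintro ⟨m, ⟨-, -, rfl | rfl⟩, rfl⟩
    · left; rfl
    · right; rfl
  · rintro (rfl | rfl)
    · exact ⟨_, ⟨h, by omega, Or.inl (by omega)⟩, rfl⟩
    · exact ⟨_, ⟨by omega, hlt, Or.inr rfl⟩, rfl⟩

theorem SG_succ_eq_mexPair {b n : ℕ} (hb : 2 ≤ b) (hn : 1 ≤ n) :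
    SG b (n + 1) = mexPair (SG b (n / b + 1)) (SG b n) := by
  have h := SG_mul_add_succ (n := n / b) (d := n % b) hb (Nat.mod_lt _ (by omega))
    (by rw [Nat.div_add_mod]; exact hn)
  rwa [Nat.div_add_mod] at h

theorem SG_succ_ne {b n : ℕ} (hb : 2 ≤ b) (hn : 1 ≤ n) : SG b (n + 1) ≠ SG b n := by
  rw [SG_succ_eq_mexPair hb hn]; exact mexPair_ne_right _ _

theorem SG_le_two {b : ℕ} (hb : 2 ≤ b) (n : ℕ) : SG b n ≤ 2 := by
  rcases Nat.lt_or_ge 1 n with hn | hn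
  · obtain ⟨m, rfl⟩ := Nat.exists_eq_add_of_lt hn
    rw [SG_succ_eq_mexPair hb (by omega)]
    exact mexPair_le_two _ _
  · simp [SG_of_le_one b hn]

theorem SG_mul_add {b n : ℕ} (hb : 2 ≤ b) (hn : 1 ≤ n) {d : ℕ} (hd : d ≤ b) :
    SG b (b * n + d) = (mexPair (SG b (n + 1)))^[d] (SG b (b * n)) := by
  induction d with
  | zero => rfl
  | succ d ih =>
    rw [Function.iterate_succ_apply', ← ih (by omega), ← add_assoc]
    exact SG_mul_add_succ hb hd (by nlinarith)

theorem SG_two {b : ℕ} (hb : 2 ≤ b) : SG b 2 = 1 := by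
  have h := SG_mul_add_succ (n := 0) (d := 1) hb (by omega) (by omega)
  simpa [SG_of_le_one, mexPair] using h

/-- In the first block `c = SG b 1 = 0`, so the values run 0, 1, 2, 1, 2, …. -/
theorem SG_even_of_le {b i : ℕ} (hb : 2 ≤ b) (hi : 2 * (i + 1) ≤ b) :
    SG b (2 * (i + 1)) = 1 := by
  induction i with
  | zero => exact SG_two hb
  | succ i ih =>
    have h₁ := SG_mul_add_succ (n := 0) (d := 2 * (i + 1)) hb (by omega) (by omega)
    have h₂ := SG_mul_add_succ (n := 0) (d := 2 * (i + 1) + 1) hb (by omega) (by omega)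
    simp only [mul_zero, zero_add, SG_of_le_one b le_rfl] at h₁ h₂
    rw [ih (by omega)] at h₁
    rw [h₁] at h₂
    simpa [mexPair, mul_add, add_assoc] using h₂

theorem SG_self {b : ℕ} (hb : 2 ≤ b) (he : Even b) : SG b b = 1 := by
  obtain ⟨j, hj⟩ := he
  have h := SG_even_of_le (i := j - 1) hb (by omega)
  rwa [show 2 * (j - 1 + 1) = b by omega] at h

/-- An even positive number of rounds of `mexPair c`, started at a nonzero value, keeps the value
if it is not `c` and exchanges `1` and `2` otherwise. -/
theorem iterate_mexPair {c x : ℕ} (hc : c ≤ 2) (hx : x = 1 ∨ x = 2) (j : ℕ) :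
    (mexPair c)^[2 * (j + 1)] x = if c = 0 then x else 3 - c := by
  induction j with
  | zero =>
    rcases hx with rfl | rfl <;> interval_cases c <;> rfl
  | succ j ih =>
    rw [show 2 * (j + 1 + 1) = 2 * (j + 1) + 1 + 1 by ring, Function.iterate_succ_apply',
      Function.iterate_succ_apply', ih]
    rcases hx with rfl | rfl <;> interval_cases c <;> rfl

theorem SG_mul_succ {b n : ℕ} (hb : 2 ≤ b) (he : Even b) (hn : 1 ≤ n)
    (hx : SG b (b * n) = 1 ∨ SG b (b * n) = 2) :
    SG b (b * (n + 1)) = if SG b (n + 1) = 0 then SG b (b * n) else 3 - SG b (n + 1) := by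
  obtain ⟨j, hj⟩ := he
  have h := iterate_mexPair (SG_le_two hb (n + 1)) hx (j - 1)
  rw [show 2 * (j - 1 + 1) = b by omega] at h
  rw [mul_add, mul_one, SG_mul_add hb hn le_rfl, h]

theorem SG_mul_eq_one_or_two {b n : ℕ} (hb : 2 ≤ b) (he : Even b) (hn : 1 ≤ n) :
    SG b (b * n) = 1 ∨ SG b (b * n) = 2 := by
  induction n, hn using Nat.le_induction with
  | base => left; rw [mul_one]; exact SG_self hb he
  | succ n hn ih =>
    rw [SG_mul_succ hb he hn ih]
    have := SG_le_two hb (n + 1)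
    split_ifs <;> omega

/-- The value at a multiple `b * n` is determined by the values at `n` and at `n - 1`. -/
theorem SG_mul_eq {b n : ℕ} (hb : 2 ≤ b) (he : Even b) (hn : 1 ≤ n) :
    SG b (b * (n + 1)) = if SG b (n + 1) = 0 then 3 - SG b n else 3 - SG b (n + 1) := by
  rw [SG_mul_succ hb he hn (SG_mul_eq_one_or_two hb he hn)]
  split_ifs with h0
  · obtain rfl | ⟨m, hm, rfl⟩ : n = 1 ∨ ∃ m, 1 ≤ m ∧ n = m + 1 := by
      rcases Nat.lt_or_ge 1 n with h | h
      · exact Or.inr ⟨n - 1, by omega, by omega⟩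
      · exact Or.inl (by omega)
    · simp [SG_two hb] at h0
    · have hne := SG_succ_ne hb hn
      rw [SG_mul_succ hb he hm (SG_mul_eq_one_or_two hb he hm), if_neg (by omega)]
  · rfl

/-- A sequence is automatic if it factors through a map with finite range whose value at
`k * n + d` depends only on its value at `n` and on the digit `d`. -/
theorem IsAutomatic.of_congr {Δ τ : Type} {k : ℕ} {a : ℕ → Δ} (S : ℕ → τ)
    (hfin : (Set.range S).Finite)
    (hS : ∀ m n d, d < k → S m = S n → S (k * m + d) = S (k * n + d))
    (ha : ∀ m n, S m = S n → a m = a n) : IsAutomatic k a := by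
  choose r hr using fun s : Set.range S => s.2
  let M : DFAO (Fin k) (Set.range S) Δ :=
    -- By `hS`, the choice of the representative `r s` does not matter.
    { step := fun s d => ⟨S (k * r s + d), Set.mem_range_self _⟩
      start := ⟨S 0, Set.mem_range_self _⟩
      out := fun s => a (r s) }
  have key : ∀ (w : List (Fin k)) (s : Set.range S) (x : ℕ), s.1 = S x →
      (w.foldl M.step s).1 = S (w.foldl (fun x d => k * x + (d : ℕ)) x) := by
    intro w
    induction w with
    | nil => intro s x h; exact h
    | cons d w ih =>
      intro s x h
      exact ih _ _ (hS _ _ _ d.2 ((hr s).trans h))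
  refine ⟨Set.range S, hfin.to_subtype, M, ?_⟩
  rintro n - w rfl
  exact ha _ _ ((hr _).trans (key w M.start 0 rfl))

/-- The values of `SG` around `n` and at `b * n`, from which those around `b * n + d` can be
computed. -/
noncomputable def SGState (b n : ℕ) : Bool × ℕ × ℕ × ℕ :=
  (decide (n = 0), SG b n, SG b (n + 1), SG b (b * n))

theorem finite_range_SGState {b : ℕ} (hb : 2 ≤ b) : (Set.range (SGState b)).Finite := by
  refine (Set.finite_univ.prod ((Set.finite_Iic 2).prod
    ((Set.finite_Iic 2).prod (Set.finite_Iic 2)))).subset ?_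
  rintro _ ⟨n, rfl⟩
  exact ⟨Set.mem_univ _, SG_le_two hb _, SG_le_two hb _, SG_le_two hb _⟩

theorem SGState_mul_add_congr {b m n d : ℕ} (hb : 2 ≤ b) (he : Even b) (hd : d < b)
    (h : SGState b m = SGState b n) : SGState b (b * m + d) = SGState b (b * n + d) := by
  simp only [SGState, Prod.mk.injEq, decide_eq_decide] at h
  -- The value at `n` itself serves only the output, not the transition.
  obtain ⟨h0, -, h1, hE⟩ := h
  -- Zero needs its own flag: the recurrence fails at position 1, where there is no move.
  rcases Nat.eq_zero_or_pos m with rfl | hm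
  · rw [h0.1 rfl]
  have hn : 1 ≤ n := by omega
  have hbm : 2 ≤ b * m := by nlinarith
  have hbn : 2 ≤ b * n := by nlinarith
  have hv : ∀ e, e ≤ b → SG b (b * m + e) = SG b (b * n + e) := fun e h => by
    rw [SG_mul_add hb hm h, SG_mul_add hb hn h, h1, hE]
  simp only [SGState, Prod.mk.injEq, decide_eq_decide]
  refine ⟨by omega, hv d hd.le, hv (d + 1) hd, ?_⟩
  cases d with
  | zero =>
    -- For `d = 0` the predecessor lies in another block, but its value is not needed because the
    -- one at `b * m` is nonzero.
    have hxm := SG_mul_eq_one_or_two hb he hm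
    have hxn := SG_mul_eq_one_or_two hb he hn
    have em := SG_mul_eq (n := b * m - 1) hb he (by omega)
    have en := SG_mul_eq (n := b * n - 1) hb he (by omega)
    rw [Nat.sub_add_cancel (by omega), if_neg (by omega)] at em en
    rw [add_zero, add_zero, em, en, hE]
  | succ d =>
    rw [← add_assoc, ← add_assoc, SG_mul_eq hb he (by omega), SG_mul_eq hb he (by omega),
      hv d (by omega), add_assoc, hv (d + 1) hd.le, ← add_assoc]

theorem theorem1 (b : ℕ) (hb_pos : 0 < b) (hb : Even b) :
    IsAutomatic b (fun n => SG b n) := by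
  have h2 : 2 ≤ b := by
    obtain ⟨j, hj⟩ := hb
    omega
  exact IsAutomatic.of_congr (SGState b) (finite_range_SGState h2)
    (fun _ _ _ hd h => SGState_mul_add_congr h2 hb hd h)
    (fun _ _ h => congrArg (fun s => s.2.1) h)
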